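/- Let $\mathcal G=(S,A^1,A^2,P,r,s_0,\gamma)$ be a two-player zero-sum discounted stochastic game with finite sets $S$ of states and $A^1,A^2$ of actions, transition probabilities $P(s,a^1,a^2,\cdot)$, reward $r(s,a^1,a^2)\in\mathbb R$ for Player 1 and $-r$ for Player 2, initial state $s_0$ and discount factor $\gamma\in[0,1)$. For stationary policies $\pi^1,\pi^2$ let $V^{\pi^1,\pi^2}(s)=\mathbb E\big[\sum_{t\ge 0}\gamma^t r(s_t,a^1_t,a^2_t)\,\big|\,s_0=s,\pi^1,\pi^2\big]$. Let $(\pi^{1,*},\pi^{2,*})$ be an equilibrium pair of stationary policies (at every state no player gains by unilaterally changing its stationary policy), $V^*=V^{\pi^{1,*},\pi^{2,*}}$ the security value, and $Q^*(s,d)$ the expected discounted return of Player 1 from $s$ if its first action is drawn from the distribution $d$ on $A^1$ and all other actions are drawn according to $\pi^{1,*},\pi^{2,*}$. Put $\mathcal D=\{\pi^{1,*}(s): s\in S\}$ and $\Delta(s)=\max_{d\in\mathcal D}Q^*(s,d)-\min_{d\in\mathcal D}Q^*(s,d)$. There are sensors $1,\dots,N$ with finite, pairwise disjoint observation sets $\Omega^i$,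 observation probabilities $O^i(s,\omega^i)$, real costs $c^i$ and a cost budget $C$; given the state, the observations of different sensors are independent. Player 1 has an arbitrary initial belief $b_0$ on $S$. At each time $t=0,1,2,\dots$, at the state $s_t$, the following happens. 1. Player 1 selects a set $I_t$ of sensors by the greedy algorithm: start with $I=\emptyset$; while $\sum_{i\in I}c^i\le C$ and $I\ne\{1,\dots,N\}$, add to $I$ a sensor $j\notin I$ that minimizes $\sum_{s\in S}H\big(\mathbb 1_s(\mathbf s)\,\big|\,(\omega^i)_{i\in I\cup\{j\}}\big)\Delta(s)$, where $H$ is the conditional entropy in bits, $\mathbf s$ has distribution $b_t$, and the $\omega^i$ are the random observations at $\mathbf s$. 2. Player 1 receives observations $\omega^i_t\sim O^i(s_t,\cdot)$, independently for $i\in I_t$, and updates its belief by Bayes' rule, $b_t'(s)=\prod_{i\in I_t}O^i(s,\omega^i_t)\,b_t(s)\big/\sum_{q\in S}\prod_{i\in I_t}O^i(q,\omega^i_t)\,b_t(q)$; if the denominator is $0$, then $b_t'$ may be any distribution on $S$. 3. Player 1 draws $a^1_t$ from some $d^{1,*}_t\in\arg\max_{d\in\mathcal D}\sum_{s\in S}b_t'(s)\,Q^*(s,d)$.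 Independently, Player 2, which knows $s_t$ and $d^{1,*}_t$, draws $a^2_t$ from some $$d^{2,*}_t\in\arg\min_{d^2}\ \sum_{a^1\in A^1}\sum_{a^2\in A^2}d^{1,*}_t(a^1)\,d^2(a^2)\Big(r(s_t,a^1,a^2)+\gamma\sum_{q\in S}P(s_t,a^1,a^2,q)\,V^*(q)\Big),$$ where the minimum is over all probability distributions $d^2$ on $A^2$. 4. The next state $s_{t+1}$ is drawn from $P(s_t,a^1_t,a^2_t,\cdot)$, and Player 1, presuming that Player 2 follows $\pi^{2,*}$, updates its belief to $b_{t+1}(s')=\sum_{s\in S}\sum_{a^2\in A^2}b_t'(s)\,\pi^{2,*}(s,a^2)\,P(s,a^1_t,a^2,s')$. All ties in these rules are broken in an arbitrary way that may depend on the deciding player's information: Player 1's own past observations and actions (and its current observations in steps 2 and 3) for Player 1, and the whole past, the current state and Player 1's current observations for Player 2. Then the expected discounted return $\nu=\mathbb E\big[\sum_{t\ge0}\gamma^t r(s_t,a^1_t,a^2_t)\big]$ of Player 1 in this play satisfies $$\nu\le V^*(s_0).$$ -/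

import Mathlib

open MeasureTheory ProbabilityTheory
open scoped ENNReal

namespace SensorGame

noncomputable section

/-! ## Random processes with a given step rule -/

/-- The first `n` entries of a sequence, most recent first. -/
def past {X : Type*} (x : ℕ → X) : ℕ → List X
  | 0 => []
  | n + 1 => x n :: past x n

/-- The past of a trajectory that is known up to time `n` (inclusive). -/
def pastIic {X : Type*} (n : ℕ) (x : (i : Finset.Iic n) → X) : List X :=
  past (fun k => x ⟨min k n, Finset.mem_Iic.2 (min_le_right k n)⟩) (n + 1)

/-- The transition kernel from trajectories up to time `n` to the entry at time `n + 1`. -/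
def stepKernel {X : Type*} [MeasurableSpace X] [DiscreteMeasurableSpace X] [Countable X]
    (step : List X → PMF X) (n : ℕ) : Kernel ((i : Finset.Iic n) → X) X :=
  Kernel.ofFunOfCountable fun x => (step (pastIic n x)).toMeasure

instance {X : Type*} [MeasurableSpace X] [DiscreteMeasurableSpace X] [Countable X]
    (step : List X → PMF X) (n : ℕ) : IsMarkovKernel (stepKernel step n) :=
  ⟨fun x => PMF.toMeasure.isProbabilityMeasure (step (pastIic n x))⟩

/-- The law on infinite sequences `x 0, x 1, …` such that, given `x 0, …, x (n - 1)`, the entry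
`x n` has distribution `step [x (n - 1), …, x 0]` (Ionescu-Tulcea). -/
def processLaw {X : Type*} [MeasurableSpace X] [DiscreteMeasurableSpace X] [Countable X]
    (step : List X → PMF X) : Measure (ℕ → X) :=
  Kernel.trajMeasure (X := fun _ => X) (step []).toMeasure (stepKernel step)

/-- The expected discounted return `𝔼[∑ₜ γ ^ t * f (xₜ)]`. -/
def expectedReturn {X : Type*} [MeasurableSpace X] (γ : ℝ) (μ : Measure (ℕ → X)) (f : X → ℝ) : ℝ :=
  ∫ x, ∑' t : ℕ, γ ^ t * f (x t) ∂μ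

/-! ## Two-player zero-sum discounted stochastic games -/

/-- A two-player zero-sum stochastic game: `P` is the transition function, `r` the reward that
Player 1 receives from Player 2, `s₀` the initial state and `γ` the discount factor. The state and
action sets are finite where the game is used, so the reward is bounded. -/
structure StochasticGame (S A₁ A₂ : Type*) where
  P : S → A₁ → A₂ → PMF S
  r : S → A₁ → A₂ → ℝ
  s₀ : S
  γ : ℝ
  γ_nonneg : 0 ≤ γ
  γ_lt_one : γ < 1

/-- A state together with the actions that the players take there. -/
structure Stage (S A₁ A₂ : Type*) where
  state : S
  act₁ : A₁
  act₂ : A₂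

instance {S A₁ A₂ : Type*} : MeasurableSpace (Stage S A₁ A₂) := ⊤

instance {S A₁ A₂ : Type*} : DiscreteMeasurableSpace (Stage S A₁ A₂) := ⟨fun _ => trivial⟩

instance {S A₁ A₂ : Type*} [Finite S] [Finite A₁] [Finite A₂] : Finite (Stage S A₁ A₂) :=
  Finite.of_injective (fun x => (x.state, x.act₁, x.act₂)) (by
    rintro ⟨⟩ ⟨⟩ h; simpa using h)

namespace StochasticGame

variable {S A₁ A₂ : Type*}

/-- The distribution of a stage whose state is `s` and whose actions are drawn independently from
`d₁` and `d₂`. -/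
def drawStage (s : S) (d₁ : PMF A₁) (d₂ : PMF A₂) : PMF (Stage S A₁ A₂) :=
  d₁.bind fun a₁ => d₂.bind fun a₂ => PMF.pure ⟨s, a₁, a₂⟩

/-- The step rule of the game that starts at `s`, with actions drawn from `d₁` and `d₂` at time `0`
and according to the stationary policies `π₁` and `π₂` afterwards. -/
def stageStep (G : StochasticGame S A₁ A₂) (π₁ : S → PMF A₁) (π₂ : S → PMF A₂)
    (s : S) (d₁ : PMF A₁) (d₂ : PMF A₂) : List (Stage S A₁ A₂) → PMF (Stage S A₁ A₂)
  | [] => drawStage s d₁ d₂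
  | x :: _ => (G.P x.state x.act₁ x.act₂).bind fun q => drawStage q (π₁ q) (π₂ q)

/-- `Q^{π₁, π₂}(s, d₁, d₂)`: Player 1's expected discounted return from `s` if the first actions are
drawn from `d₁` and `d₂`, and the later ones according to `π₁` and `π₂`. -/
def Q₂ [Finite S] [Finite A₁] [Finite A₂] (G : StochasticGame S A₁ A₂)
    (π₁ : S → PMF A₁) (π₂ : S → PMF A₂) (s : S) (d₁ : PMF A₁) (d₂ : PMF A₂) : ℝ :=
  expectedReturn G.γ (processLaw (G.stageStep π₁ π₂ s d₁ d₂))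
    fun x => G.r x.state x.act₁ x.act₂

/-- `Q^{π₁, π₂}(s, d₁)`: the first action of Player 1 is drawn from `d₁`, all other actions of the
players according to `π₁` and `π₂`. -/
def Q₁ [Finite S] [Finite A₁] [Finite A₂] (G : StochasticGame S A₁ A₂)
    (π₁ : S → PMF A₁) (π₂ : S → PMF A₂) (s : S) (d₁ : PMF A₁) : ℝ :=
  G.Q₂ π₁ π₂ s d₁ (π₂ s)

/-- `V^{π₁, π₂}(s)`: Player 1's expected discounted return from `s` under `π₁` and `π₂`. -/
def V [Finite S] [Finite A₁] [Finite A₂] (G : StochasticGame S A₁ A₂)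
    (π₁ : S → PMF A₁) (π₂ : S → PMF A₂) (s : S) : ℝ :=
  G.Q₂ π₁ π₂ s (π₁ s) (π₂ s)

/-- `(π₁, π₂)` is an equilibrium pair of stationary policies: at every state, no player gains by
changing its stationary policy unilaterally. -/
def IsEquilibrium [Finite S] [Finite A₁] [Finite A₂] (G : StochasticGame S A₁ A₂)
    (π₁ : S → PMF A₁) (π₂ : S → PMF A₂) : Prop :=
  ∀ s, (∀ π₁' : S → PMF A₁, G.V π₁' π₂ s ≤ G.V π₁ π₂ s) ∧
    ∀ π₂' : S → PMF A₂, G.V π₁ π₂ s ≤ G.V π₁ π₂' s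

/-- The value of an equilibrium pair is the security value of Player 1, `max_{π₁} min_{π₂} V`. -/
theorem IsEquilibrium.maxmin [Finite S] [Finite A₁] [Finite A₂] {G : StochasticGame S A₁ A₂}
    {π₁ : S → PMF A₁} {π₂ : S → PMF A₂} (h : G.IsEquilibrium π₁ π₂) (s : S) :
    IsGreatest {v | ∃ ρ₁ : S → PMF A₁, IsLeast (Set.range fun ρ₂ => G.V ρ₁ ρ₂ s) v}
      (G.V π₁ π₂ s) := by
  refine ⟨⟨π₁, ⟨π₂, rfl⟩, ?_⟩, ?_⟩
  · rintro _ ⟨ρ₂, rfl⟩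
    exact (h s).2 ρ₂
  · rintro v ⟨ρ₁, -, hv⟩
    exact (hv ⟨π₂, rfl⟩).trans ((h s).1 ρ₁)

/-- The value of an equilibrium pair is the security value of Player 2, `min_{π₂} max_{π₁} V`. -/
theorem IsEquilibrium.minmax [Finite S] [Finite A₁] [Finite A₂] {G : StochasticGame S A₁ A₂}
    {π₁ : S → PMF A₁} {π₂ : S → PMF A₂} (h : G.IsEquilibrium π₁ π₂) (s : S) :
    IsLeast {v | ∃ ρ₂ : S → PMF A₂, IsGreatest (Set.range fun ρ₁ => G.V ρ₁ ρ₂ s) v}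
      (G.V π₁ π₂ s) := by
  refine ⟨⟨π₂, ⟨π₁, rfl⟩, ?_⟩, ?_⟩
  · rintro _ ⟨ρ₁, rfl⟩
    exact (h s).1 ρ₁
  · rintro v ⟨ρ₂, -, hv⟩
    exact ((h s).2 ρ₂).trans (hv ⟨π₁, rfl⟩)

end StochasticGame

/-! ## Sensors -/

/-- What Player 1 observes in one time step: the set of the sensors it uses, and one observation
from each of them. -/
abbrev Obs {ι : Type*} (Ω : ι → Type*) : Type _ :=
  Σ I : Finset ι, ((i : {i // i ∈ I}) → Ω i)

/-- Sensors `i : ι` with observation functions `O i`, costs, and a cost budget. The observation sets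
`Ω i` are disjoint as they are distinct types. -/
structure Sensors (S : Type*) {ι : Type*} (Ω : ι → Type*) where
  O : (i : ι) → S → PMF (Ω i)
  cost : ι → ℝ
  budget : ℝ

/-- The conditional entropy `H(X | Y)` in bits, for the joint mass function `p` of `(X, Y)`. -/
def condEntropy {X Y : Type*} [Fintype X] [Fintype Y] (p : X → Y → ℝ) : ℝ :=
  -∑ x, ∑ y, p x y * Real.logb 2 (p x y / ∑ x', p x' y)

namespace Sensors

variable {S ι : Type*} {Ω : ι → Type*} [DecidableEq ι] [∀ i, Fintype (Ω i)]

/-- The probability of the observations `ω` of the sensors in `I` at the state `s`; the sensors are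
independent given the state. -/
def likelihood (K : Sensors S Ω) (I : Finset ι) (s : S) (ω : (i : {i // i ∈ I}) → Ω i) : ℝ≥0∞ :=
  ∏ i : {i // i ∈ I}, K.O i s (ω i)

/-- The joint distribution of the observations of the sensors in `I` at the state `s`. -/
def obsLaw (K : Sensors S Ω) (I : Finset ι) (s : S) : PMF ((i : {i // i ∈ I}) → Ω i) :=
  PMF.ofFintype (K.likelihood I s) (by
    unfold likelihood
    rw [← Fintype.prod_sum fun (i : {i // i ∈ I}) (w : Ω i) => K.O i s w]
    refine Finset.prod_eq_one fun i _ => ?_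
    rw [← tsum_fintype (L := .unconditional _)]
    exact (K.O i s).tsum_coe)

variable [Fintype S] [DecidableEq S]

/-- The joint mass function of the indicator of `s` at the random state, and of the observations of
the sensors in `I`, if the random state has distribution `b`. -/
def indicatorMass (K : Sensors S Ω) (b : PMF S) (I : Finset ι) (s : S) (x : Bool)
    (ω : (i : {i // i ∈ I}) → Ω i) : ℝ :=
  ∑ q : S, if decide (q = s) = x then (b q * K.likelihood I q ω).toReal else 0

/-- The value-loss weighted entropy of the sensor set `I` under the belief `b`, with weights `Δ`. -/
def objective (K : Sensors S Ω) (Δ : S → ℝ) (b : PMF S) (I : Finset ι) : ℝ :=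
  ∑ s : S, condEntropy (K.indicatorMass b I s) * Δ s

variable [Fintype ι]

/-- The loop condition of the greedy algorithm. -/
def Continues (K : Sensors S Ω) (I : Finset ι) : Prop :=
  ∑ i ∈ I, K.cost i ≤ K.budget ∧ I ≠ Finset.univ

/-- The sensor sets that the loop of the greedy algorithm can reach. At each pass it adds a sensor
that minimizes the objective; ties may be broken in any way. -/
inductive Reaches (K : Sensors S Ω) (Δ : S → ℝ) (b : PMF S) : Finset ι → Prop
  | init : Reaches K Δ b ∅
  | add (I : Finset ι) (j : ι) : Reaches K Δ b I → K.Continues I → j ∉ I →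
      (∀ k, k ∉ I → K.objective Δ b (insert j I) ≤ K.objective Δ b (insert k I)) →
      Reaches K Δ b (insert j I)

/-- `I` is a possible output of the greedy algorithm. -/
def IsGreedyOutput (K : Sensors S Ω) (Δ : S → ℝ) (b : PMF S) (I : Finset ι) : Prop :=
  K.Reaches Δ b I ∧ ¬ K.Continues I

/-- `b'` is a posterior of `b` given the observation `o`: it is given by Bayes' rule if `b` gives
`o` a positive probability, and it may be any distribution if not. -/
def IsPosterior (K : Sensors S Ω) (b : PMF S) (o : Obs Ω) (b' : PMF S) : Prop :=
  ∑ q, K.likelihood o.1 q o.2 * b q ≠ 0 →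
    ∀ s, b' s = K.likelihood o.1 s o.2 * b s / ∑ q, K.likelihood o.1 q o.2 * b q

end Sensors

/-! ## The behavior of the players -/

namespace StochasticGame

variable {S A₁ A₂ : Type*}

/-- The belief at the next time step, from the belief `b'` after observations, Player 1's action
`a₁`, and the presumed policy `π₂` of Player 2:
`s' ↦ ∑ s, ∑ a₂, b' s * π₂ s a₂ * P s a₁ a₂ s'`. The sum over all `s'` is `1`, so Bayes' rule needs
no normalization. -/
def predict (G : StochasticGame S A₁ A₂) (π₂ : S → PMF A₂) (b' : PMF S) (a₁ : A₁) : PMF S :=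
  b'.bind fun s => (π₂ s).bind fun a₂ => G.P s a₁ a₂

/-- `max_{d ∈ 𝒟} Q*(s, d) - min_{d ∈ 𝒟} Q*(s, d)`, where `𝒟` is the (finite) set of the action
distributions that `π₁` uses. -/
def gap [Finite S] [Finite A₁] [Finite A₂] (G : StochasticGame S A₁ A₂)
    (π₁ : S → PMF A₁) (π₂ : S → PMF A₂) (s : S) : ℝ :=
  sSup (G.Q₁ π₁ π₂ s '' Set.range π₁) - sInf (G.Q₁ π₁ π₂ s '' Set.range π₁)

/-- `d₁` maximizes `∑ s, b' s * Q*(s, d₁)` over the set `𝒟` of the action distributions that `π₁`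
uses. -/
def IsQMDPChoice [Fintype S] [Finite A₁] [Finite A₂] (G : StochasticGame S A₁ A₂)
    (π₁ : S → PMF A₁) (π₂ : S → PMF A₂) (b' : PMF S) (d₁ : PMF A₁) : Prop :=
  d₁ ∈ Set.range π₁ ∧
    IsMaxOn (fun d => ∑ s, (b' s).toReal * G.Q₁ π₁ π₂ s d) (Set.range π₁) d₁

/-- Player 2's objective at the state `s`: the one-step expected reward plus the discounted expected
value of the next state, if the actions are drawn from `d₁` and `d₂`. -/
def myopicCost [Fintype S] [Fintype A₁] [Fintype A₂] (G : StochasticGame S A₁ A₂)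
    (π₁ : S → PMF A₁) (π₂ : S → PMF A₂) (s : S) (d₁ : PMF A₁) (d₂ : PMF A₂) : ℝ :=
  ∑ a₁, ∑ a₂, (d₁ a₁).toReal * (d₂ a₂).toReal *
    (G.r s a₁ a₂ + G.γ * ∑ q, (G.P s a₁ a₂ q).toReal * G.V π₁ π₂ q)

end StochasticGame

/-- How Player 1 plays: its initial belief `b₀`, the sensors it selects, its belief after
observations, and the distribution of its action. They depend on Player 1's own observations and
actions in the past (most recent first) and, for the last two, on the current observations. -/
structure Player₁ (S A₁ : Type*) {ι : Type*} (Ω : ι → Type*) where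
  prior : PMF S
  sensors : List (Obs Ω × A₁) → Finset ι
  posterior : List (Obs Ω × A₁) → Obs Ω → PMF S
  dist : List (Obs Ω × A₁) → Obs Ω → PMF A₁

namespace Player₁

variable {S A₁ A₂ ι : Type*} {Ω : ι → Type*}

/-- Player 1's belief before observations, given its own past. It presumes that Player 2 follows
`π₂`. -/
def belief (σ : Player₁ S A₁ Ω) (G : StochasticGame S A₁ A₂) (π₂ : S → PMF A₂) :
    List (Obs Ω × A₁) → PMF S
  | [] => σ.prior
  | (o, a₁) :: h => G.predict π₂ (σ.posterior h o) a₁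

/-- Player 1 follows the perception and action rules: it selects sensors with the greedy algorithm,
updates its beliefs by Bayes' rule and chooses its action distribution with the `Q_MDP`-type rule.
Ties may be broken in any way. -/
structure IsRationallyInattentive [Fintype S] [DecidableEq S] [Fintype A₁] [Fintype A₂] [Fintype ι]
    [DecidableEq ι] [∀ i, Fintype (Ω i)] (σ : Player₁ S A₁ Ω) (G : StochasticGame S A₁ A₂)
    (π₁ : S → PMF A₁) (π₂ : S → PMF A₂) (K : Sensors S Ω) : Prop where
  sensors : ∀ h, K.IsGreedyOutput (G.gap π₁ π₂) (σ.belief G π₂ h) (σ.sensors h)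
  posterior : ∀ h o, K.IsPosterior (σ.belief G π₂ h) o (σ.posterior h o)
  dist : ∀ h o, G.IsQMDPChoice π₁ π₂ (σ.posterior h o) (σ.dist h o)

end Player₁

/-- One time step of the play: the state, Player 1's observations, and the actions. -/
structure Round (S A₁ A₂ : Type*) {ι : Type*} (Ω : ι → Type*) where
  state : S
  obs : Obs Ω
  act₁ : A₁
  act₂ : A₂

section Play

variable {S A₁ A₂ ι : Type*} {Ω : ι → Type*}

instance : MeasurableSpace (Round S A₁ A₂ Ω) := ⊤

instance : DiscreteMeasurableSpace (Round S A₁ A₂ Ω) := ⟨fun _ => trivial⟩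

instance [Finite S] [Finite A₁] [Finite A₂] [Finite ι] [∀ i, Finite (Ω i)] :
    Finite (Round S A₁ A₂ Ω) :=
  Finite.of_injective (fun x => (x.state, x.obs, x.act₁, x.act₂)) (by
    rintro ⟨⟩ ⟨⟩ h; simpa using h)

/-- What Player 1 knows about a list of past rounds. -/
def view₁ (h : List (Round S A₁ A₂ Ω)) : List (Obs Ω × A₁) :=
  h.map fun x => (x.obs, x.act₁)

/-- Player 2's action distribution, as a function of the past rounds (most recent first), the
current state and the current observations of Player 1. -/
abbrev Player₂ (S A₁ A₂ : Type*) {ι : Type*} (Ω : ι → Type*) : Type _ :=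
  List (Round S A₁ A₂ Ω) → S → Obs Ω → PMF A₂

/-- Player 2 follows the myopic rule: its action distribution minimizes, over all distributions on
its actions, the one-step expected reward plus the discounted expected security value of the next
state, given the action distribution of Player 1. -/
def Player₂.IsMyopic [Fintype S] [Fintype A₁] [Fintype A₂] (τ : Player₂ S A₁ A₂ Ω)
    (G : StochasticGame S A₁ A₂) (π₁ : S → PMF A₁) (π₂ : S → PMF A₂) (σ : Player₁ S A₁ Ω) : Prop :=
  ∀ h s o, IsMinOn (G.myopicCost π₁ π₂ s (σ.dist (view₁ h) o)) Set.univ (τ h s o)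

/-- The distribution of the state after the given past. -/
def nextState (G : StochasticGame S A₁ A₂) : List (Round S A₁ A₂ Ω) → PMF S
  | [] => PMF.pure G.s₀
  | x :: _ => G.P x.state x.act₁ x.act₂

/-- The timeline of a round: the state is drawn, Player 1 selects sensors and gets observations
from them, then the players draw their actions independently. -/
def playStep [DecidableEq ι] [∀ i, Fintype (Ω i)] (G : StochasticGame S A₁ A₂) (K : Sensors S Ω)
    (σ : Player₁ S A₁ Ω) (τ : Player₂ S A₁ A₂ Ω) (h : List (Round S A₁ A₂ Ω)) :
    PMF (Round S A₁ A₂ Ω) :=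
  (nextState G h).bind fun s =>
  (K.obsLaw (σ.sensors (view₁ h)) s).bind fun ω =>
  (σ.dist (view₁ h) ⟨σ.sensors (view₁ h), ω⟩).bind fun a₁ =>
  (τ h s ⟨σ.sensors (view₁ h), ω⟩).bind fun a₂ =>
  PMF.pure ⟨s, ⟨σ.sensors (view₁ h), ω⟩, a₁, a₂⟩

/-- Player 1's expected discounted return in the play of `σ` against `τ`. -/
def playReturn [Finite S] [Finite A₁] [Finite A₂] [Finite ι] [DecidableEq ι] [∀ i, Fintype (Ω i)]
    (G : StochasticGame S A₁ A₂) (K : Sensors S Ω) (σ : Player₁ S A₁ Ω) (τ : Player₂ S A₁ A₂ Ω) :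
    ℝ :=
  expectedReturn G.γ (processLaw (playStep G K σ τ)) fun x => G.r x.state x.act₁ x.act₂

end Play

end

end SensorGame

namespace SensorGame

noncomputable section

/-! ## Expectations with respect to mass functions on finite types -/

/-! Write V for the equilibrium value. For whatever distribution `d₁` Player 1 uses at a state s,
Player 2 could answer with `π₂ s`, and its myopic choice is at least as good for the objective
"reward now plus discounted V at the next state". Against `π₂`, no first action of Player 1 pushes
this objective above V(s) (`IsEquilibrium.bellman_le`). This bound holds for each `d₁` separately,
so it survives averaging over observations, and the beliefs behind `d₁` play no role. Hence the
conditional expectation of V at the next state, as a function of the past, is a bounded potential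
that dominates the expected reward of a round plus the discounted potential after it. Summing and
telescoping (`expectedReturn_le`) bounds the return by the initial potential V(s₀). Equilibrium only
speaks of stationary deviations. The passage to one-shot deviations uses the Bellman equation
`bellman_V` and the comparison `bellman_le_Q₂`, which rests on the same potential argument with
reversed inequalities. -/

/-- The expectation of `f` under `p`. -/
def expect {α : Type*} (p : PMF α) (f : α → ℝ) : ℝ :=
  ∑' a, (p a).toReal * f a

section Expect

variable {α β : Type*}

theorem expect_eq_sum [Fintype α] (p : PMF α) (f : α → ℝ) :
    expect p f = ∑ a, (p a).toReal * f a :=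
  tsum_fintype _

theorem sum_toReal_coe [Fintype α] (p : PMF α) : ∑ a, (p a).toReal = 1 := by
  rw [← ENNReal.toReal_sum fun a _ => p.apply_ne_top a, ← tsum_fintype (L := .unconditional _),
    p.tsum_coe, ENNReal.toReal_one]

variable [Finite α] [Finite β]

@[simp] theorem expect_const (p : PMF α) (c : ℝ) : expect p (fun _ => c) = c := by
  cases nonempty_fintype α
  rw [expect_eq_sum, ← Finset.sum_mul, sum_toReal_coe, one_mul]

theorem expect_add (p : PMF α) (f g : α → ℝ) :
    expect p (fun a => f a + g a) = expect p f + expect p g := by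
  cases nonempty_fintype α
  simp only [expect_eq_sum, mul_add, Finset.sum_add_distrib]

theorem expect_const_mul (p : PMF α) (c : ℝ) (f : α → ℝ) :
    expect p (fun a => c * f a) = c * expect p f := by
  cases nonempty_fintype α
  simp only [expect_eq_sum, Finset.mul_sum, mul_left_comm]

theorem expect_neg (p : PMF α) (f : α → ℝ) : expect p (fun a => -f a) = -expect p f := by
  simpa using expect_const_mul p (-1) f

theorem expect_mono (p : PMF α) {f g : α → ℝ} (h : ∀ a, f a ≤ g a) :
    expect p f ≤ expect p g := by
  cases nonempty_fintype α
  simp only [expect_eq_sum]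
  gcongr with a
  exact h a

theorem exists_abs_le (f : α → ℝ) : ∃ C, ∀ x, |f x| ≤ C := by
  obtain ⟨C, hC⟩ := (Set.finite_range fun x => |f x|).bddAbove
  exact ⟨C, fun x => hC ⟨x, rfl⟩⟩

theorem abs_expect_le (p : PMF α) {f : α → ℝ} {C : ℝ} (h : ∀ a, |f a| ≤ C) :
    |expect p f| ≤ C := by
  rw [abs_le]
  constructor
  · simpa using expect_mono p (f := fun _ => -C) fun a => (abs_le.1 (h a)).1
  · simpa using expect_mono p (g := fun _ => C) fun a => (abs_le.1 (h a)).2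

@[simp] theorem expect_pure (a : α) (f : α → ℝ) : expect (PMF.pure a) f = f a := by
  classical
  cases nonempty_fintype α
  rw [expect_eq_sum, Finset.sum_eq_single a] <;> simp +contextual [PMF.pure_apply]

theorem expect_bind (p : PMF α) (k : α → PMF β) (f : β → ℝ) :
    expect (p.bind k) f = expect p fun a => expect (k a) f := by
  cases nonempty_fintype α
  cases nonempty_fintype β
  have hb (b : β) : ((p.bind k) b).toReal = ∑ a, (p a).toReal * (k a b).toReal := by
    rw [PMF.bind_apply, tsum_fintype, ENNReal.toReal_sum fun a _ =>
      ENNReal.mul_ne_top (p.apply_ne_top a) ((k a).apply_ne_top b)]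
    simp only [ENNReal.toReal_mul]
  simp only [expect_eq_sum, hb, Finset.sum_mul, Finset.mul_sum, mul_assoc]
  exact Finset.sum_comm

theorem integral_toMeasure [MeasurableSpace α] [DiscreteMeasurableSpace α] (p : PMF α)
    (f : α → ℝ) : ∫ a, f a ∂p.toMeasure = expect p f := by
  cases nonempty_fintype α
  simp [PMF.integral_eq_sum, expect_eq_sum]

end Expect

/-! ## The law of a random process -/

section Law

variable {X : Type*}

theorem past_congr {x y : ℕ → X} {n : ℕ} (h : ∀ k < n, x k = y k) : past x n = past y n := by
  induction n with
  | zero => rfl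
  | succ n ih =>
    rw [past, past, h n n.lt_succ_self, ih fun _ hk => h _ (hk.trans n.lt_succ_self)]

theorem pastIic_frestrictLe (n : ℕ) (x : ℕ → X) :
    pastIic n (Preorder.frestrictLe n x) = past x (n + 1) :=
  -- The truncation `min k n` in `pastIic` is inactive, as only indices up to `n` are read.
  past_congr fun k hk => congrArg x (min_eq_left (Nat.lt_succ_iff.1 hk))

variable [MeasurableSpace X] [DiscreteMeasurableSpace X]

instance [Countable X] (step : List X → PMF X) : IsProbabilityMeasure (processLaw step) := by
  have := PMF.toMeasure.isProbabilityMeasure (step [])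
  unfold processLaw
  infer_instance

theorem map_eval_zero_processLaw [Countable X] (step : List X → PMF X) :
    (processLaw step).map (fun x => x 0) = (step []).toMeasure := by
  have h : (fun x : ℕ → X => x 0) =
      MeasurableEquiv.piUnique (fun _ : Finset.Iic 0 => X) ∘ Preorder.frestrictLe 0 := rfl
  rw [h, ← Measure.map_map (by fun_prop) (by fun_prop), processLaw, Kernel.trajMeasure,
    Measure.map_comp _ _ (by fun_prop), Kernel.traj_map_frestrictLe, Kernel.partialTraj_self,
    Measure.id_comp, Measure.map_map (by fun_prop) (by fun_prop)]
  exact Measure.map_id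

variable [Finite X]

/-- A past factors through the trajectories on `Finset.Iic (n - 1)`, a finite discrete space, where
every function is measurable and bounded. The empty past needs its own case because `Finset.Iic 0`
already contains time 0. -/
theorem measurable_past_comp (g : List X → ℝ) (n : ℕ) :
    Measurable fun x : ℕ → X => g (past x n) := by
  cases n with
  | zero => exact measurable_const (a := g [])
  | succ n =>
    simp only [← pastIic_frestrictLe]
    exact (Measurable.of_discrete (f := fun y : (i : Finset.Iic n) → X => g (pastIic n y))).comp
      (by fun_prop)

theorem integrable_past_comp (step : List X → PMF X) (g : List X → ℝ) (n : ℕ) :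
    Integrable (fun x => g (past x n)) (processLaw step) := by
  cases n with
  | zero => exact integrable_const (g [])
  | succ n =>
    simp only [← pastIic_frestrictLe]
    obtain ⟨C, hC⟩ := (Set.finite_range
      fun y : (i : Finset.Iic n) → X => ‖g (pastIic n y)‖).bddAbove
    have hm := (measurable_past_comp g (n + 1)).aestronglyMeasurable (μ := processLaw step)
    simp only [← pastIic_frestrictLe] at hm
    exact .of_bound hm C (.of_forall fun x => hC ⟨_, rfl⟩)

/-- The tower property, the only place where the conditional laws of the process enter. For a
nonempty past it is the disintegration of the trajectory measure along `stepKernel`. -/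
theorem integral_past_succ (step : List X → PMF X) (g : List X → ℝ) (n : ℕ) :
    ∫ x, g (past x (n + 1)) ∂processLaw step =
      ∫ x, expect (step (past x n)) (fun y => g (y :: past x n)) ∂processLaw step := by
  have := PMF.toMeasure.isProbabilityMeasure (step [])
  cases n with
  | zero =>
    have h := integral_map (μ := processLaw step) (φ := fun x => x 0)
      (measurable_pi_apply 0).aemeasurable (f := fun y => g [y]) (Measurable.of_discrete).aestronglyMeasurable
    rw [map_eval_zero_processLaw, integral_toMeasure] at h
    simp [past, ← h]
  | succ n =>
    let F : ((i : Finset.Iic n) → X) × X → ℝ := fun p => g (p.2 :: pastIic n p.1)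
    have hF : StronglyMeasurable F := (Measurable.of_discrete (f := F)).stronglyMeasurable
    have hm : Measurable fun x : ℕ → X => (Preorder.frestrictLe n x, x (n + 1)) := by fun_prop
    obtain ⟨C, hC⟩ := (Set.finite_range fun p => ‖F p‖).bddAbove
    have h₁ : ∫ x, g (past x (n + 1 + 1)) ∂processLaw step =
        ∫ p, F p ∂(processLaw step).map
          (fun x => (Preorder.frestrictLe n x, x (n + 1))) := by
      rw [integral_map hm.aemeasurable hF.aestronglyMeasurable]
      simp only [F, pastIic_frestrictLe]
      rfl
    have hmap := Kernel.map_frestrictLe_trajMeasure_compProd_eq_map_trajMeasure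
      (X := fun _ => X) (μ₀ := (step []).toMeasure) (κ := stepKernel step) (a := n)
    rw [h₁, processLaw, ← hmap]
    have : IsProbabilityMeasure ((Kernel.trajMeasure (X := fun _ => X) (step []).toMeasure
        (stepKernel step)).map (Preorder.frestrictLe n)) :=
      Measure.isProbabilityMeasure_map (by fun_prop)
    rw [Measure.integral_compProd (.of_bound hF.aestronglyMeasurable C
        (.of_forall fun p => hC ⟨_, rfl⟩)),
      integral_map (by fun_prop) (Measurable.of_discrete).aestronglyMeasurable]
    refine integral_congr_ae (.of_forall fun x => ?_)
    change ∫ y, F (Preorder.frestrictLe n x, y)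
      ∂(step (pastIic n (Preorder.frestrictLe n x))).toMeasure = _
    simp only [F, integral_toMeasure, pastIic_frestrictLe]

/-- Dominated convergence: rewards on a finite type are bounded, so a geometric series dominates. -/
theorem hasSum_expectedReturn (step : List X → PMF X) {γ : ℝ} (h₀ : 0 ≤ γ) (h₁ : γ < 1)
    (f : X → ℝ) :
    HasSum (fun t => γ ^ t * ∫ x, f (x t) ∂processLaw step)
      (expectedReturn γ (processLaw step) f) := by
  obtain ⟨C, hC⟩ := exists_abs_le f
  have hb (t : ℕ) (x : ℕ → X) : ‖γ ^ t * f (x t)‖ ≤ γ ^ t * C := by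
    rw [norm_mul, norm_pow, Real.norm_of_nonneg h₀]
    exact mul_le_mul_of_nonneg_left (hC _) (pow_nonneg h₀ t)
  have hs : Summable fun t => γ ^ t * C := (summable_geometric_of_lt_one h₀ h₁).mul_right C
  have hm (t : ℕ) : Measurable fun x : ℕ → X => γ ^ t * f (x t) :=
    ((Measurable.of_discrete (f := f)).comp (measurable_pi_apply t)).const_mul _
  simp only [← integral_const_mul]
  exact hasSum_integral_of_dominated_convergence (fun t _ => γ ^ t * C)
    (fun t => (hm t).aestronglyMeasurable) (fun t => .of_forall (hb t))
    (.of_forall fun _ => hs) (integrable_const _)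
    (.of_forall fun x => (Summable.of_norm_bounded hs fun t => hb t x).hasSum)

/-- A bounded potential that dominates the expected reward of a step plus the discounted potential
after the step dominates the expected discounted return. -/
theorem expectedReturn_le (step : List X → PMF X) {γ : ℝ} (h₀ : 0 ≤ γ) (h₁ : γ < 1)
    (f : X → ℝ) (W : List X → ℝ) {C : ℝ} (hC : ∀ h, |W h| ≤ C)
    (hW : ∀ h, expect (step h) (fun x => f x + γ * W (x :: h)) ≤ W h) :
    expectedReturn γ (processLaw step) f ≤ W [] := by
  set μ := processLaw step with hμ
  have hstep (t : ℕ) : ∫ x, f (x t) ∂μ + γ * ∫ x, W (past x (t + 1)) ∂μ ≤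
      ∫ x, W (past x t) ∂μ := by
    -- The default 0 is never used below: `g` is only evaluated at nonempty pasts.
    let g : List X → ℝ := fun l => (l.head?.elim 0 f) + γ * W l
    have hg := integral_past_succ step g t
    have hf : Integrable (fun x => f (x t)) μ :=
      integrable_past_comp step (fun l => l.head?.elim 0 f) (t + 1)
    have hl : ∫ x, g (past x (t + 1)) ∂μ =
        ∫ x, f (x t) ∂μ + γ * ∫ x, W (past x (t + 1)) ∂μ := by
      rw [← integral_const_mul, ← integral_add hf
        ((integrable_past_comp step W (t + 1)).const_mul γ)]
      rfl
    rw [← hl, hg]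
    exact integral_mono (integrable_past_comp step
      (fun l => expect (step l) fun y => g (y :: l)) t) (integrable_past_comp step W t)
      fun x => hW (past x t)
  -- Weighting `hstep` by `γ ^ t` makes the potentials telescope; the remainder vanishes because `W`
  -- is bounded.
  have hsum (n : ℕ) : ∑ t ∈ Finset.range n, γ ^ t * ∫ x, f (x t) ∂μ ≤
      W [] - γ ^ n * ∫ x, W (past x n) ∂μ := by
    induction n with
    | zero => simp [past, hμ]
    | succ n ih =>
      rw [Finset.sum_range_succ, pow_succ]
      nlinarith [mul_le_mul_of_nonneg_left (hstep n) (pow_nonneg h₀ n)]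
  have hlim : Filter.Tendsto (fun n => γ ^ n * ∫ x, W (past x n) ∂μ) Filter.atTop (nhds 0) := by
    refine squeeze_zero_norm (a := fun n => γ ^ n * C) (fun n => ?_) (by
      simpa using (tendsto_pow_atTop_nhds_zero_of_lt_one h₀ h₁).mul_const C)
    rw [norm_mul, norm_pow, Real.norm_of_nonneg h₀]
    refine mul_le_mul_of_nonneg_left ?_ (pow_nonneg h₀ n)
    simpa using norm_integral_le_of_norm_le_const (μ := μ) (f := fun x => W (past x n))
      (.of_forall fun x => hC (past x n))
  exact le_of_tendsto_of_tendsto' (hasSum_expectedReturn step h₀ h₁ f).tendsto_sum_nat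
    (by simpa using hlim.const_sub (W [])) hsum

theorem le_expectedReturn (step : List X → PMF X) {γ : ℝ} (h₀ : 0 ≤ γ) (h₁ : γ < 1)
    (f : X → ℝ) (W : List X → ℝ) {C : ℝ} (hC : ∀ h, |W h| ≤ C)
    (hW : ∀ h, W h ≤ expect (step h) (fun x => f x + γ * W (x :: h))) :
    W [] ≤ expectedReturn γ (processLaw step) f := by
  have h := expectedReturn_le step h₀ h₁ (fun x => -f x) (fun h => -W h) (C := C)
    (by simpa using hC) (fun h => by
      have := hW h
      rw [← neg_le_neg_iff, ← expect_neg] at this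
      refine le_trans (le_of_eq ?_) this
      congr 1 with x
      ring)
  simp only [expectedReturn, mul_neg, tsum_neg, integral_neg] at h
  exact neg_le_neg_iff.1 h

end Law

/-! ## Bellman equations -/

namespace StochasticGame

variable {S A₁ A₂ : Type*} [Finite S]

/-- The expected reward of the first step plus the discounted expectation of `v` at the next state,
if the actions are drawn from `d₁` and `d₂`. -/
def bellman (G : StochasticGame S A₁ A₂) (v : S → ℝ) (s : S) (d₁ : PMF A₁) (d₂ : PMF A₂) : ℝ :=
  expect d₁ fun a₁ => expect d₂ fun a₂ => G.r s a₁ a₂ + G.γ * expect (G.P s a₁ a₂) v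

/-- The expectation of `v` at the state after the given stages; `c` if there are none. -/
def stagePotential (G : StochasticGame S A₁ A₂) (v : S → ℝ) (c : ℝ) : List (Stage S A₁ A₂) → ℝ
  | [] => c
  | x :: _ => expect (G.P x.state x.act₁ x.act₂) v

theorem exists_abs_stagePotential_le (G : StochasticGame S A₁ A₂) (v : S → ℝ) (c : ℝ) :
    ∃ C, ∀ h, |G.stagePotential v c h| ≤ C := by
  obtain ⟨C, hC⟩ := exists_abs_le v
  refine ⟨max C |c|, fun h => ?_⟩
  cases h with
  | nil => exact le_max_right _ _
  | cons x h => exact (abs_expect_le _ hC).trans (le_max_left _ _)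

variable [Finite A₁] [Finite A₂]

theorem expect_drawStage (s : S) (d₁ : PMF A₁) (d₂ : PMF A₂) (g : Stage S A₁ A₂ → ℝ) :
    expect (drawStage s d₁ d₂) g = expect d₁ fun a₁ => expect d₂ fun a₂ => g ⟨s, a₁, a₂⟩ := by
  simp [drawStage, expect_bind]

theorem expect_stageStep_nil (G : StochasticGame S A₁ A₂) (π₁ : S → PMF A₁) (π₂ : S → PMF A₂)
    (v : S → ℝ) (c : ℝ) (s : S) (d₁ : PMF A₁) (d₂ : PMF A₂) :
    expect (G.stageStep π₁ π₂ s d₁ d₂ [])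
      (fun x => G.r x.state x.act₁ x.act₂ + G.γ * G.stagePotential v c [x]) =
      G.bellman v s d₁ d₂ :=
  expect_drawStage ..

theorem expect_stageStep_cons (G : StochasticGame S A₁ A₂) (π₁ : S → PMF A₁) (π₂ : S → PMF A₂)
    (v : S → ℝ) (c : ℝ) (s : S) (d₁ : PMF A₁) (d₂ : PMF A₂) (y : Stage S A₁ A₂)
    (h : List (Stage S A₁ A₂)) :
    expect (G.stageStep π₁ π₂ s d₁ d₂ (y :: h))
      (fun x => G.r x.state x.act₁ x.act₂ + G.γ * G.stagePotential v c (x :: y :: h)) =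
      expect (G.P y.state y.act₁ y.act₂) fun q => G.bellman v q (π₁ q) (π₂ q) := by
  simp only [stageStep, expect_bind, expect_drawStage]
  rfl

/-- A supersolution `v` for the stationary policies gives the potential from time 1 on. The first
actions are free, since the right-hand side accounts for them exactly. -/
theorem Q₂_le_bellman (G : StochasticGame S A₁ A₂) {π₁ : S → PMF A₁} {π₂ : S → PMF A₂}
    {v : S → ℝ} (hv : ∀ s, G.bellman v s (π₁ s) (π₂ s) ≤ v s) (s : S) (d₁ : PMF A₁)
    (d₂ : PMF A₂) : G.Q₂ π₁ π₂ s d₁ d₂ ≤ G.bellman v s d₁ d₂ := by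
  -- This value at the empty past turns the potential inequality at time 0 into an equality.
  obtain ⟨C, hC⟩ := G.exists_abs_stagePotential_le v (G.bellman v s d₁ d₂)
  refine expectedReturn_le _ G.γ_nonneg G.γ_lt_one _ _ hC fun h => ?_
  cases h with
  | nil => exact (expect_stageStep_nil ..).le
  | cons y h => exact (expect_stageStep_cons ..).trans_le (expect_mono _ hv)

theorem bellman_le_Q₂ (G : StochasticGame S A₁ A₂) {π₁ : S → PMF A₁} {π₂ : S → PMF A₂}
    {v : S → ℝ} (hv : ∀ s, v s ≤ G.bellman v s (π₁ s) (π₂ s)) (s : S) (d₁ : PMF A₁)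
    (d₂ : PMF A₂) : G.bellman v s d₁ d₂ ≤ G.Q₂ π₁ π₂ s d₁ d₂ := by
  obtain ⟨C, hC⟩ := G.exists_abs_stagePotential_le v (G.bellman v s d₁ d₂)
  refine le_expectedReturn _ G.γ_nonneg G.γ_lt_one _ _ hC fun h => ?_
  cases h with
  | nil => exact (expect_stageStep_nil ..).ge
  | cons y h => exact (expect_mono _ hv).trans_eq (expect_stageStep_cons ..).symm

theorem bellman_le_add (G : StochasticGame S A₁ A₂) {v w : S → ℝ} {c : ℝ}
    (h : ∀ s, v s ≤ w s + c) (s : S) (d₁ : PMF A₁) (d₂ : PMF A₂) :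
    G.bellman v s d₁ d₂ ≤ G.bellman w s d₁ d₂ + G.γ * c := by
  have h' : G.bellman w s d₁ d₂ + G.γ * c = expect d₁ fun a₁ => expect d₂ fun a₂ =>
      G.r s a₁ a₂ + G.γ * expect (G.P s a₁ a₂) fun q => w q + c := by
    simp only [bellman, expect_add, expect_const, mul_add, ← add_assoc]
  rw [h']
  refine expect_mono _ fun a₁ => expect_mono _ fun a₂ => ?_
  gcongr
  · exact G.γ_nonneg
  · exact expect_mono _ h

/-- Banach's fixed point theorem in the sup norm: by `bellman_le_add` the operator is a
`γ`-contraction. -/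
theorem exists_bellman_eq (G : StochasticGame S A₁ A₂) (π₁ : S → PMF A₁) (π₂ : S → PMF A₂) :
    ∃ v : S → ℝ, ∀ s, G.bellman v s (π₁ s) (π₂ s) = v s := by
  cases nonempty_fintype S
  let T : (S → ℝ) → S → ℝ := fun v s => G.bellman v s (π₁ s) (π₂ s)
  have hT : ContractingWith ⟨G.γ, G.γ_nonneg⟩ T := by
    refine ⟨by exact_mod_cast G.γ_lt_one, LipschitzWith.of_dist_le_mul fun v w => ?_⟩
    have hvw (v w : S → ℝ) (s : S) : T v s ≤ T w s + G.γ * dist v w :=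
      G.bellman_le_add (fun q => by
        have := (le_abs_self _).trans ((Real.dist_eq (v q) (w q)).ge.trans (dist_le_pi_dist v w q))
        linarith) ..
    refine (dist_pi_le_iff (mul_nonneg G.γ_nonneg dist_nonneg)).2 fun s => ?_
    rw [Real.dist_eq, abs_le]
    have h₁ := hvw v w s
    have h₂ := hvw w v s
    rw [dist_comm] at h₂
    exact ⟨by change -(G.γ * _) ≤ _; linarith, by change _ ≤ G.γ * _; linarith⟩
  exact ⟨hT.fixedPoint, fun s => congrFun hT.fixedPoint_isFixedPt s⟩

/-- A fixed point is both a super- and a subsolution, so the two comparisons squeeze `V` onto it. No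
shift of the trajectory law is needed. -/
theorem bellman_V (G : StochasticGame S A₁ A₂) (π₁ : S → PMF A₁) (π₂ : S → PMF A₂) (s : S) :
    G.bellman (G.V π₁ π₂) s (π₁ s) (π₂ s) = G.V π₁ π₂ s := by
  obtain ⟨v, hv⟩ := G.exists_bellman_eq π₁ π₂
  have hV : G.V π₁ π₂ = v := funext fun s => le_antisymm
    ((G.Q₂_le_bellman (fun s => (hv s).le) s _ _).trans_eq (hv s))
    ((hv s).ge.trans (G.bellman_le_Q₂ (fun s => (hv s).ge) s _ _))
  rw [hV, hv]

/-- At an equilibrium, no distribution of Player 1's first action improves on the value. -/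
theorem IsEquilibrium.bellman_le {G : StochasticGame S A₁ A₂} {π₁ : S → PMF A₁}
    {π₂ : S → PMF A₂} (h : G.IsEquilibrium π₁ π₂) (s : S) (d₁ : PMF A₁) :
    G.bellman (G.V π₁ π₂) s d₁ (π₂ s) ≤ G.V π₁ π₂ s := by
  classical
  by_contra! hlt
  -- The one-shot improvement is made stationary by using it at every visit to `s`. Then the old
  -- value is a subsolution for `ρ`: strictly at `s`, with equality elsewhere. So `ρ` would earn
  -- more than the value at `s`.
  let ρ : S → PMF A₁ := Function.update π₁ s d₁
  have hρ (q : S) : G.V π₁ π₂ q ≤ G.bellman (G.V π₁ π₂) q (ρ q) (π₂ q) := by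
    by_cases hq : q = s
    · subst hq
      simpa [ρ] using hlt.le
    · simpa [ρ, hq] using (G.bellman_V π₁ π₂ q).ge
  have hs := (G.bellman_le_Q₂ hρ s (ρ s) (π₂ s)).trans ((h s).1 ρ)
  simp only [ρ, Function.update_self] at hs
  exact hlt.not_ge hs

theorem myopicCost_eq_bellman [Fintype S] [Fintype A₁] [Fintype A₂] (G : StochasticGame S A₁ A₂)
    (π₁ : S → PMF A₁) (π₂ : S → PMF A₂) (s : S) (d₁ : PMF A₁) (d₂ : PMF A₂) :
    G.myopicCost π₁ π₂ s d₁ d₂ = G.bellman (G.V π₁ π₂) s d₁ d₂ := by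
  simp only [myopicCost, bellman, expect_eq_sum, Finset.mul_sum, mul_assoc]

end StochasticGame

/-! ## The play -/

theorem Player₂.IsMyopic.bellman_le {S A₁ A₂ ι : Type*} {Ω : ι → Type*} [Fintype S] [Fintype A₁]
    [Fintype A₂] {τ : Player₂ S A₁ A₂ Ω} {G : StochasticGame S A₁ A₂} {π₁ : S → PMF A₁}
    {π₂ : S → PMF A₂} {σ : Player₁ S A₁ Ω} (hτ : τ.IsMyopic G π₁ π₂ σ)
    (hπ : G.IsEquilibrium π₁ π₂) (h : List (Round S A₁ A₂ Ω)) (s : S) (o : Obs Ω) :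
    G.bellman (G.V π₁ π₂) s (σ.dist (view₁ h) o) (τ h s o) ≤ G.V π₁ π₂ s := by
  -- The equilibrium action `π₂ s` is the competitor in Player 2's minimization.
  have hmin := hτ h s o (Set.mem_univ (π₂ s))
  simp only [Set.mem_ofPred_eq, StochasticGame.myopicCost_eq_bellman] at hmin
  exact hmin.trans (hπ.bellman_le s _)

theorem expect_playStep {S A₁ A₂ ι : Type*} {Ω : ι → Type*} [Finite S] [Finite A₁] [Finite A₂]
    [Finite ι] [DecidableEq ι] [∀ i, Fintype (Ω i)] (G : StochasticGame S A₁ A₂) (K : Sensors S Ω)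
    (σ : Player₁ S A₁ Ω) (τ : Player₂ S A₁ A₂ Ω) (v : S → ℝ) (h : List (Round S A₁ A₂ Ω)) :
    expect (playStep G K σ τ h)
      (fun x => G.r x.state x.act₁ x.act₂ + G.γ * expect (nextState G (x :: h)) v) =
      expect (nextState G h) fun s => expect (K.obsLaw (σ.sensors (view₁ h)) s) fun ω =>
        G.bellman v s (σ.dist (view₁ h) ⟨_, ω⟩) (τ h s ⟨_, ω⟩) := by
  simp only [playStep, expect_bind, expect_pure]
  rfl

end

end SensorGame

theorem proposition2 {S A₁ A₂ ι : Type*} {Ω : ι → Type*}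
    [Fintype S] [DecidableEq S] [Fintype A₁] [Fintype A₂]
    [Fintype ι] [DecidableEq ι] [∀ i, Fintype (Ω i)]
    (G : SensorGame.StochasticGame S A₁ A₂)
    (π₁ : S → PMF A₁) (π₂ : S → PMF A₂) (hπ : G.IsEquilibrium π₁ π₂)
    (K : SensorGame.Sensors S Ω)
    (σ : SensorGame.Player₁ S A₁ Ω) (hσ : σ.IsRationallyInattentive G π₁ π₂ K)
    (τ : SensorGame.Player₂ S A₁ A₂ Ω) (hτ : τ.IsMyopic G π₁ π₂ σ) :
    SensorGame.playReturn G K σ τ ≤ G.V π₁ π₂ G.s₀ := by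
  obtain ⟨C, hC⟩ := SensorGame.exists_abs_le (G.V π₁ π₂)
  -- At the empty past `nextState` is the point mass at `G.s₀`, so the initial potential is the
  -- value there.
  refine (SensorGame.expectedReturn_le (SensorGame.playStep G K σ τ) G.γ_nonneg G.γ_lt_one _
    (fun h => SensorGame.expect (SensorGame.nextState G h) (G.V π₁ π₂))
    (fun h => SensorGame.abs_expect_le _ hC) fun h => ?_).trans_eq
    (SensorGame.expect_pure _ _)
  rw [SensorGame.expect_playStep]
  refine SensorGame.expect_mono _ fun s => ?_
  -- For a fixed state the bound does not depend on the observations, so their average collapses by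
  -- `expect_const`.
  simpa using SensorGame.expect_mono (K.obsLaw (σ.sensors (SensorGame.view₁ h)) s)
    fun ω => hτ.bellman_le hπ h s ⟨_, ω⟩
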